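/- Let $k\ge 1$ be an integer and let $\mathcal S_n$ denote the set of permutations of size $n$ ($\mathcal S_0$ consists of the empty permutation only). For $\pi\in\mathcal S_k$ and $\sigma\in\mathcal S_n$, $n\ge 1$, let $\widetilde{\mathrm{c\text{-}occ}}(\pi,\sigma)$ be $\frac1n$ times the number of intervals $\{i,i+1,\dots,i+k-1\}\subseteq\{1,\dots,n\}$ such that $\sigma(i)\dots\sigma(i+k-1)$ has the same relative order as $\pi$. Let the feasible region $P_k\subseteq[0,1]^{\mathcal S_k}$ be the set of all vectors $\vec v$ for which there is a sequence of permutations $(\sigma^m)_{m}$ with $|\sigma^m|\to\infty$ and $\widetilde{\mathrm{c\text{-}occ}}(\pi,\sigma^m)\to\vec v_\pi$ for all $\pi\in\mathcal S_k$. The overlap graph $Ov(k)$ is the directed multigraph with vertex set $\mathcal S_{k-1}$ and with one edge for each $\pi\in\mathcal S_k$, going from the pattern induced by the first $k-1$ indices of $\pi$ to the pattern induced by the last $k-1$ indices of $\pi$. For a non-empty (directed) cycle $\mathcal C$ in $Ov(k)$, let $\vec e_{\mathcal C}\in\mathbb R^{\mathcal S_k}$ be the vector whose coordinate at an edge $\pi$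 is the number of occurrences of $\pi$ in $\mathcal C$ divided by the length of $\mathcal C$; a simple cycle is a non-empty cycle that does not repeat vertices (a loop is a simple cycle of length $1$). The cycle polytope of $Ov(k)$ is the convex hull of the vectors $\vec e_{\mathcal C}$ over all simple cycles $\mathcal C$ of $Ov(k)$. **Theorem.** $P_k$ is equal to the cycle polytope of $Ov(k)$. Its (affine) dimension is $k!-(k-1)!$, and its set of vertices (extreme points) is exactly $\{\vec e_{\mathcal C} : \mathcal C \text{ a simple cycle of } Ov(k)\}$. -/

import Mathlib

/-! ### Patterns and the feasible region for consecutive patterns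

The set of permutations of size `n` is `Equiv.Perm (Fin n)`. -/

namespace PermPattern

/-- Two sequences of length `m` have the same relative order. -/
def SameOrder {m : ℕ} {α β : Type*} [LT α] [LT β] (f : Fin m → α) (g : Fin m → β) : Prop :=
  ∀ a b : Fin m, f a < f b ↔ g a < g b

/-- The index `i` (counted from `0`) is the starting point of a consecutive occurrence of `π`
in `σ`: the entries of `σ` at the indices `i, i + 1, …, i + k - 1` exist and have the same
relative order as `π`. -/
def IsConsecOcc {k n : ℕ} (π : Equiv.Perm (Fin k)) (σ : Equiv.Perm (Fin n)) (i : ℕ) : Prop :=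
  ∃ h : i + k ≤ n,
    SameOrder π (fun a : Fin k => σ ⟨i + a, lt_of_lt_of_le (Nat.add_lt_add_left a.isLt i) h⟩)

open scoped Classical in
/-- The number of consecutive occurrences of `π` in `σ`. (A nonempty interval of indices is
determined by its starting point.) -/
noncomputable def coc {k n : ℕ} (π : Equiv.Perm (Fin k)) (σ : Equiv.Perm (Fin n)) : ℕ :=
  ((Finset.range n).filter (fun i => IsConsecOcc π σ i)).card

/-- The proportion of consecutive occurrences of `π` in `σ`. -/
noncomputable def cocProp {k n : ℕ} (π : Equiv.Perm (Fin k)) (σ : Equiv.Perm (Fin n)) : ℝ :=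
  (coc π σ : ℝ) / (n : ℝ)

/-- The feasible region `P_k`: limits of the vectors of proportions of consecutive occurrences of
the patterns of size `k`, along sequences of permutations whose size tends to infinity. -/
def feasibleRegion (k : ℕ) : Set (Equiv.Perm (Fin k) → ℝ) :=
  {v | (∀ π, v π ∈ Set.Icc (0 : ℝ) 1) ∧
    ∃ σ : ℕ → (Σ n : ℕ, Equiv.Perm (Fin n)),
      Filter.Tendsto (fun m => (σ m).1) Filter.atTop Filter.atTop ∧
      ∀ π : Equiv.Perm (Fin k),
        Filter.Tendsto (fun m => cocProp π (σ m).2) Filter.atTop (nhds (v π))}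

/-- The pattern of a sequence `f` of `m` pairwise distinct values: the permutation of size `m`
with the same relative order as `f`, sending an index to its rank (see `sameOrder_pat`). -/
def pat {m : ℕ} {α : Type*} [LinearOrder α] (f : Fin m → α) : Equiv.Perm (Fin m) :=
  (Tuple.sort f)⁻¹

theorem sameOrder_pat {m : ℕ} {α : Type*} [LinearOrder α] (f : Fin m → α)
    (hf : Function.Injective f) : SameOrder (pat f) f := by
  have hs : StrictMono (f ∘ Tuple.sort f) :=
    (Tuple.monotone_sort f).strictMono_of_injective (hf.comp (Tuple.sort f).injective)
  intro a b
  have h := hs.lt_iff_lt (a := pat f a) (b := pat f b)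
  simpa [pat] using h.symm

end PermPattern

/-! ### Directed multigraphs and cycle polytopes -/

/-- A directed multigraph with vertex set `V` and edge set `E`: every edge has a source and a
target. Loops and parallel edges are allowed. -/
structure DirMultigraph (V E : Type*) where
  src : E → V
  tgt : E → V

namespace DirMultigraph

variable {V E : Type*}

/-- A nonempty cycle, given by its list of edges: every edge ends where the next one starts, and
the last edge ends where the first one starts. -/
def IsCycle (G : DirMultigraph V E) (C : List E) : Prop :=
  ∃ h : C ≠ [], C.IsChain (fun e f => G.tgt e = G.src f) ∧
    G.tgt (C.getLast h) = G.src (C.head h)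

/-- A simple cycle is a nonempty cycle that does not repeat vertices. The vertices of a cycle are
the sources of its edges. -/
def IsSimpleCycle (G : DirMultigraph V E) (C : List E) : Prop :=
  G.IsCycle C ∧ (C.map G.src).Nodup

/-- The vector `e_C`: the coordinate at `e` is the number of occurrences of `e` in `C`, divided
by the length of `C`. -/
noncomputable def cycleVec [DecidableEq E] (C : List E) : E → ℝ :=
  fun e => (C.count e : ℝ) / (C.length : ℝ)

/-- The set of the vectors `e_C`, for `C` a simple cycle of `G`. -/
def simpleCycleVecs [DecidableEq E] (G : DirMultigraph V E) : Set (E → ℝ) :=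
  {v | ∃ C : List E, G.IsSimpleCycle C ∧ v = cycleVec C}

/-- The cycle polytope of `G`. -/
def cyclePolytope [DecidableEq E] (G : DirMultigraph V E) : Set (E → ℝ) :=
  convexHull ℝ G.simpleCycleVecs

end DirMultigraph

namespace PermPattern

/-- The overlap graph `Ov(k)`: its vertices are the permutations of size `k - 1`, its edges are
the permutations `π` of size `k`, and `π` goes from the pattern induced by its first `k - 1`
indices to the pattern induced by its last `k - 1` indices. -/
def overlapGraph (k : ℕ) : DirMultigraph (Equiv.Perm (Fin (k - 1))) (Equiv.Perm (Fin k)) where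
  src π := pat (fun a : Fin (k - 1) => π ⟨a, by omega⟩)
  tgt π := pat (fun a : Fin (k - 1) => π ⟨a + 1, by omega⟩)

end PermPattern

/-! Both polytopes are identified with `circulationPolytope`, the unit flows on the edges of the
overlap graph.

The windows of length `k` of a permutation form a walk in `Ov(k)`. A walk leaves a vertex as often
as it enters it, up to one, and a permutation of size `n ≥ k` has `n + 1 - k` windows. Dividing by
`n` and passing to the limit gives a circulation (`feasibleRegion_subset_circulationPolytope`).

The extreme circulations are the simple cycle vectors: the support of a circulation contains a
simple cycle, a small multiple of which can be split off, and a simple cycle carries only one unit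
flow. Krein–Milman then gives the cycle polytope.

Conversely, every walk is read off some sequence, since a next entry with any prescribed relative
position can be inserted (`exists_extension`). Going round a cycle many times realizes its vector,
and direct sums realize convex combinations.

For the dimension, the uniform vector is a strictly positive circulation, so only the linear
equations matter. Their rank is `(k - 1)!` because the graph is connected. -/

namespace DirMultigraph

variable {V E : Type*}

/-! ### Circulations and simple cycles in a finite multigraph -/

/-- The probability vectors on the edges of `G` that satisfy flow conservation at every vertex. -/
def circulationPolytope [Fintype E] [DecidableEq V] (G : DirMultigraph V E) : Set (E → ℝ) :=
  {v | (∀ e, 0 ≤ v e) ∧ ∑ e, v e = 1 ∧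
    ∀ x, ∑ e with G.src e = x, v e = ∑ e with G.tgt e = x, v e}

theorem map_tgt_cons (G : DirMultigraph V E) (e : E) (l : List E)
    (h : (e :: l).IsChain (fun e f => G.tgt e = G.src f)) :
    (e :: l).map G.tgt = l.map G.src ++ [G.tgt ((e :: l).getLast (List.cons_ne_nil _ _))] := by
  induction l generalizing e with
  | nil => simp
  | cons f l ih =>
    rw [List.isChain_cons_cons] at h
    rw [List.map_cons, ih f h.2, h.1]
    simp

/-- Around a cycle the targets are the sources shifted by one place. This is flow conservation for
`cycleVec`. -/
theorem IsCycle.perm_map {G : DirMultigraph V E} {C : List E} (h : G.IsCycle C) :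
    (C.map G.tgt).Perm (C.map G.src) := by
  obtain ⟨h0, hc, hl⟩ := h
  cases C with
  | nil => exact absurd rfl h0
  | cons e l =>
    rw [map_tgt_cons G e l hc, hl]
    simp

theorem sum_count_filter [Fintype E] [DecidableEq E] [DecidableEq V] (g : E → V) (x : V)
    (C : List E) : ∑ e with g e = x, C.count e = (C.map g).count x := by
  induction C with
  | nil => simp
  | cons a l ih =>
    simp only [List.count_cons, Finset.sum_add_distrib, ih, List.map_cons, beq_iff_eq]
    congr 1
    rw [Finset.sum_ite_eq]
    simp

theorem sum_count [Fintype E] [DecidableEq E] (C : List E) : ∑ e, C.count e = C.length := by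
  have := Multiset.sum_count_eq_card (s := Finset.univ) (m := (C : Multiset E)) (by simp)
  simpa using this

theorem IsCycle.cycleVec_mem [Fintype E] [DecidableEq E] [DecidableEq V]
    {G : DirMultigraph V E} {C : List E} (h : G.IsCycle C) :
    cycleVec C ∈ G.circulationPolytope := by
  have hL : (C.length : ℝ) ≠ 0 := by
    simpa using h.1
  refine ⟨fun e => by unfold cycleVec; positivity, ?_, fun x => ?_⟩
  · simp only [cycleVec]
    rw [← Finset.sum_div, ← Nat.cast_sum, sum_count, div_self hL]
  · simp only [cycleVec]
    rw [← Finset.sum_div, ← Finset.sum_div, ← Nat.cast_sum, ← Nat.cast_sum, sum_count_filter,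
      sum_count_filter, h.perm_map.count_eq]

theorem convex_circulationPolytope [Fintype E] [DecidableEq V] (G : DirMultigraph V E) :
    Convex ℝ G.circulationPolytope := by
  intro v hv w hw a b ha hb hab
  refine ⟨fun e => ?_, ?_, fun x => ?_⟩
  · have := hv.1 e
    have := hw.1 e
    simp only [Pi.add_apply, Pi.smul_apply, smul_eq_mul]
    positivity
  · simp only [Pi.add_apply, Pi.smul_apply, smul_eq_mul, Finset.sum_add_distrib,
      ← Finset.mul_sum, hv.2.1, hw.2.1, mul_one, hab]
  · simp only [Pi.add_apply, Pi.smul_apply, smul_eq_mul, Finset.sum_add_distrib,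
      ← Finset.mul_sum, hv.2.2, hw.2.2]

theorem isCompact_circulationPolytope [Fintype E] [DecidableEq V] (G : DirMultigraph V E) :
    IsCompact G.circulationPolytope := by
  refine (isCompact_stdSimplex ℝ E).of_isClosed_subset ?_ fun v hv => ⟨hv.1, hv.2.1⟩
  simp only [circulationPolytope, Set.ofPred_and, Set.ofPred_forall]
  refine IsClosed.inter (isClosed_iInter fun e => isClosed_le continuous_const (by fun_prop))
    (IsClosed.inter (isClosed_eq (by fun_prop) continuous_const)
      (isClosed_iInter fun x => isClosed_eq (by fun_prop) (by fun_prop)))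

theorem apply_eq_head_of_isChain (G : DirMultigraph V E) {v : E → ℝ} (e : E) (l : List E)
    (hc : (e :: l).IsChain (fun e f => G.tgt e = G.src f))
    (h : ∀ a ∈ e :: l, ∀ b ∈ e :: l, G.tgt a = G.src b → v a = v b) :
    ∀ a ∈ e :: l, v a = v e := by
  induction l generalizing e with
  | nil => simp
  | cons f l ih =>
    rw [List.isChain_cons_cons] at hc
    intro a ha
    have hef : v e = v f := h e (by simp) f (by simp) hc.1
    rcases List.mem_cons.1 ha with rfl | ha
    · rfl
    · rw [hef]
      exact ih f hc.2 (fun a ha b hb => h a (List.mem_cons_of_mem _ ha) b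
        (List.mem_cons_of_mem _ hb)) a ha

theorem IsSimpleCycle.nodup {G : DirMultigraph V E} {C : List E} (h : G.IsSimpleCycle C) :
    C.Nodup := h.2.of_map _

theorem IsSimpleCycle.cycleVec_apply_of_mem [DecidableEq E] {G : DirMultigraph V E} {C : List E}
    (h : G.IsSimpleCycle C) {e : E} (he : e ∈ C) : cycleVec C e = 1 / C.length := by
  simp [cycleVec, List.count_eq_one_of_mem h.nodup he]

theorem cycleVec_apply_of_notMem [DecidableEq E] {C : List E} {e : E} (he : e ∉ C) :
    cycleVec C e = 0 := by
  simp [cycleVec, List.count_eq_zero_of_not_mem he]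

/-- A circulation carried by a simple cycle is the vector of this cycle. -/
theorem IsSimpleCycle.eq_cycleVec [Fintype E] [DecidableEq E] [DecidableEq V]
    {G : DirMultigraph V E} {C : List E} (h : G.IsSimpleCycle C) {v : E → ℝ}
    (hv : v ∈ G.circulationPolytope) (hC : ∀ e ∉ C, v e = 0) : v = cycleVec C := by
  have hs := List.inj_on_of_nodup_map h.2
  have ht := List.inj_on_of_nodup_map (h.1.perm_map.nodup_iff.2 h.2)
  -- Sources, and likewise targets, are distinct along `C`. So at the common vertex only `a` brings
  -- flow in and only `b` takes flow out.
  have key : ∀ a ∈ C, ∀ b ∈ C, G.tgt a = G.src b → v a = v b := by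
    intro a ha b hb hab
    have h1 : ∑ e with G.src e = G.src b, v e = v b := by
      refine Finset.sum_eq_single b (fun e he hne => ?_) (by simp)
      by_contra h0
      exact hne (hs (by_contra fun hn => h0 (hC e hn)) hb (by simpa using he))
    have h2 : ∑ e with G.tgt e = G.src b, v e = v a := by
      refine Finset.sum_eq_single a (fun e he hne => ?_) (by simp [hab])
      by_contra h0
      exact hne (ht (by_contra fun hn => h0 (hC e hn)) ha
        ((by simpa using he : _ = _).trans hab.symm))
    rw [← h1, ← h2, hv.2.2]
  have hc : ∃ c, ∀ e ∈ C, v e = c := by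
    obtain ⟨⟨h0, hc, -⟩, -⟩ := h
    cases C with
    | nil => exact absurd rfl h0
    | cons e l => exact ⟨v e, apply_eq_head_of_isChain G e l hc key⟩
  obtain ⟨c, hc⟩ := hc
  have hL : (C.length : ℝ) ≠ 0 := by simpa using h.1.1
  have hsum : (C.length : ℝ) * c = 1 := by
    rw [← hv.2.1, ← Finset.sum_subset (Finset.subset_univ C.toFinset)
      (fun e _ he => hC e (by simpa using he)),
      Finset.sum_congr rfl (fun e he => hc e (by simpa using he)),
      Finset.sum_const, List.toFinset_card_of_nodup h.nodup, nsmul_eq_mul]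
  funext e
  by_cases he : e ∈ C
  · rw [h.cycleVec_apply_of_mem he, hc e he]
    field_simp
    linarith
  · rw [hC e he, cycleVec_apply_of_notMem he]

/-- A simple cycle repeats no edge, so its vector depends only on its set of edges. -/
theorem finite_simpleCycleVecs [Fintype E] [DecidableEq E] (G : DirMultigraph V E) :
    G.simpleCycleVecs.Finite := by
  refine (Set.finite_range fun s : Finset E =>
    fun e => if e ∈ s then 1 / (s.card : ℝ) else 0).subset ?_
  rintro v ⟨C, hC, rfl⟩
  refine ⟨C.toFinset, funext fun e => ?_⟩
  by_cases he : e ∈ C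
  · simp [he, hC.cycleVec_apply_of_mem he, List.toFinset_card_of_nodup hC.nodup]
  · simp [he, cycleVec_apply_of_notMem he]

theorem exists_isPeriodicPt {X : Type*} [Finite X] [Nonempty X] (g : X → X) :
    ∃ y, y ∈ Function.periodicPts g := by
  obtain ⟨x⟩ := ‹Nonempty X›
  obtain ⟨m, n, hne, h⟩ := Finite.exists_ne_map_eq_of_infinite (fun n : ℕ => g^[n] x)
  wlog hmn : m < n generalizing m n
  · exact this n m hne.symm h.symm (by omega)
  refine ⟨g^[m] x, n - m, by omega, ?_⟩
  change g^[n - m] (g^[m] x) = g^[m] x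
  rw [← Function.iterate_add_apply, Nat.sub_add_cancel hmn.le]
  exact h.symm

/-- If edges of `s` can always be prolonged by edges of `s`, there is a simple cycle in `s`. -/
theorem exists_isSimpleCycle [Finite V] (G : DirMultigraph V E) (s : Set E) (hs : s.Nonempty)
    (h : ∀ e ∈ s, ∃ f ∈ s, G.src f = G.tgt e) :
    ∃ C : List E, G.IsSimpleCycle C ∧ ∀ e ∈ C, e ∈ s := by
  choose! nxt hnxt hsrc using h
  let X := G.src '' s
  have hX : ∀ x : X, ∃ e ∈ s, G.src e = x := fun x => x.2
  choose out hout hsrc' using hX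
  -- With one outgoing edge chosen at each vertex, a periodic orbit of `g` is a cycle; stopping at
  -- the minimal period keeps its vertices distinct.
  let g : X → X := fun x => ⟨G.tgt (out x), nxt (out x), hnxt _ (hout x), hsrc _ (hout x)⟩
  have : Nonempty X := (hs.image _).to_subtype
  obtain ⟨y, hy⟩ := exists_isPeriodicPt g
  have hp := Function.minimalPeriod_pos_of_mem_periodicPts hy
  set p := Function.minimalPeriod g y with hpdef
  have hstep : ∀ i, G.tgt (out (g^[i] y)) = (g^[i + 1] y : X) := by
    intro i
    rw [Function.iterate_succ_apply']
  refine ⟨(List.range p).map (fun i => out (g^[i] y)), ⟨⟨by simp [hp.ne'], ?_, ?_⟩, ?_⟩, ?_⟩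
  · rw [List.isChain_map]
    refine List.isChain_iff_getElem.2 fun i hi => ?_
    simp [hstep, hsrc']
  · simp only [List.getLast_map, List.head_map, List.getLast_range, List.head_range, hstep, hsrc']
    rw [Nat.sub_add_cancel hp, hpdef, Function.iterate_minimalPeriod]
    rfl
  · rw [List.map_map]
    refine List.Nodup.map_on ?_ List.nodup_range
    intro i hi j hj hij
    simp only [Function.comp, hsrc'] at hij
    exact Function.iterate_injOn_Iio_minimalPeriod (by simpa using hi) (by simpa using hj)
      (Subtype.ext hij)
  · simp only [List.mem_map]
    rintro e ⟨i, -, rfl⟩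
    exact hout _

theorem extremePoints_circulationPolytope [Fintype E] [DecidableEq E] [Finite V] [DecidableEq V]
    (G : DirMultigraph V E) :
    G.circulationPolytope.extremePoints ℝ = G.simpleCycleVecs := by
  ext v
  constructor
  · rintro ⟨hv, hext⟩
    have hpos : ∃ e, 0 < v e := by
      by_contra! h0
      have := Finset.sum_nonpos fun e (_ : e ∈ Finset.univ) => h0 e
      rw [hv.2.1] at this
      linarith
    obtain ⟨C, hC, hCs⟩ := G.exists_isSimpleCycle {e | 0 < v e} hpos (by
      intro e he
      by_contra! h0
      have h1 : ∑ f with G.src f = G.tgt e, v f ≤ 0 :=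
        Finset.sum_nonpos fun f hf => not_lt.1 fun hf' => h0 f hf' (by simpa using hf)
      rw [hv.2.2] at h1
      have h2 : v e ≤ ∑ f with G.tgt f = G.tgt e, v f :=
        Finset.single_le_sum (f := v) (fun f _ => hv.1 f) (by simp)
      exact absurd he (not_lt.2 (h2.trans h1)))
    refine ⟨C, hC, ?_⟩
    have hne : C.toFinset.Nonempty := by
      simpa [List.toFinset_nonempty_iff] using hC.1.1
    obtain ⟨e₀, he₀, hmin⟩ := C.toFinset.exists_min_image v hne
    have hL : (0 : ℝ) < C.length := by
      have := List.length_pos_iff.2 hC.1.1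
      exact_mod_cast this
    have hL1 : (1 : ℝ) ≤ C.length := by exact_mod_cast List.length_pos_iff.2 hC.1.1
    have he₀' : 0 < v e₀ := hCs e₀ (by simpa using he₀)
    have hle : v e₀ ≤ 1 := hv.2.1 ▸ Finset.single_le_sum (f := v) (fun f _ => hv.1 f) (by simp)
    -- Halving ensures `ε < 1` even when `C` is a loop carrying all the flow, so that the remainder
    -- can be rescaled by `(1 - ε)⁻¹`.
    set ε := v e₀ / 2 with hε
    have hε0 : 0 < ε := by positivity
    have hε1 : ε < 1 := by linarith
    have hC' := hC.1.cycleVec_mem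
    have hle' : ∀ e, ε * cycleVec C e ≤ v e := by
      intro e
      by_cases he : e ∈ C
      · rw [hC.cycleVec_apply_of_mem he]
        have h1 := hmin e (by simpa using he)
        have h2 : 1 / (C.length : ℝ) ≤ 1 := (div_le_one hL).2 hL1
        nlinarith
      · rw [cycleVec_apply_of_notMem he]
        simpa using hv.1 e
    have hne1 : 1 - ε ≠ 0 := by linarith
    refine (hext hC' (x₂ := (1 - ε)⁻¹ • (v - ε • cycleVec C)) ?_
      ⟨ε, 1 - ε, hε0, by linarith, by ring, ?_⟩).symm
    · refine ⟨fun e => ?_, ?_, fun x => ?_⟩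
      · have := hle' e
        have h3 : 0 < 1 - ε := by linarith
        simp only [Pi.smul_apply, Pi.sub_apply, smul_eq_mul]
        exact mul_nonneg (by positivity) (by linarith)
      · simp only [Pi.smul_apply, Pi.sub_apply, smul_eq_mul, ← Finset.mul_sum,
          Finset.sum_sub_distrib, hv.2.1, hC'.2.1, mul_one]
        field_simp
      · simp only [Pi.smul_apply, Pi.sub_apply, smul_eq_mul, ← Finset.mul_sum,
          Finset.sum_sub_distrib, hv.2.2, hC'.2.2]
    · rw [smul_smul, mul_inv_cancel₀ hne1]
      simp
  · rintro ⟨C, hC, rfl⟩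
    refine ⟨hC.1.cycleVec_mem, fun x hx y hy hxy => ?_⟩
    obtain ⟨a, b, ha, hb, -, hab⟩ := hxy
    refine hC.eq_cycleVec hx fun e he => ?_
    have h1 := congrFun hab e
    rw [cycleVec_apply_of_notMem he] at h1
    simp only [Pi.add_apply, Pi.smul_apply, smul_eq_mul] at h1
    have h2 := mul_nonneg hb.le (hy.1 e)
    have h3 := mul_nonneg ha.le (hx.1 e)
    exact (mul_eq_zero.1 (by linarith : a * x e = 0)).resolve_left ha.ne'

/-- Krein–Milman; the closure is superfluous because there are finitely many extreme points. -/
theorem circulationPolytope_eq_cyclePolytope [Fintype E] [DecidableEq E] [Finite V]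
    [DecidableEq V] (G : DirMultigraph V E) : G.circulationPolytope = G.cyclePolytope := by
  have h := closure_convexHull_extremePoints G.isCompact_circulationPolytope
    G.convex_circulationPolytope
  rw [extremePoints_circulationPolytope] at h
  rw [← h, cyclePolytope]
  exact (G.finite_simpleCycleVecs.isClosed_convexHull ℝ).closure_eq

/-! ### Dimension of the circulation polytope -/

/-- The incidence matrix of `G`, with an additional row (indexed by `none`) of ones. -/
def augIncMatrix [DecidableEq V] (G : DirMultigraph V E) : Matrix (Option V) E ℝ :=
  Matrix.of fun x e => x.elim 1 fun x =>
    (if G.src e = x then 1 else 0) - (if G.tgt e = x then 1 else 0)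

theorem augIncMatrix_mulVec_none [Fintype E] [DecidableEq V] (G : DirMultigraph V E) (v : E → ℝ) :
    (G.augIncMatrix.mulVec v) none = ∑ e, v e := by
  simp [Matrix.mulVec, dotProduct, augIncMatrix]

theorem augIncMatrix_mulVec_some [Fintype E] [DecidableEq V] (G : DirMultigraph V E) (v : E → ℝ)
    (x : V) : (G.augIncMatrix.mulVec v) (some x) =
      ∑ e with G.src e = x, v e - ∑ e with G.tgt e = x, v e := by
  simp [Matrix.mulVec, dotProduct, augIncMatrix, sub_mul, Finset.sum_filter]

theorem augIncMatrix_transpose_mulVec [Fintype V] [DecidableEq V] (G : DirMultigraph V E)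
    (h : Option V → ℝ) (e : E) : (G.augIncMatrix.transpose.mulVec h) e =
      h none + (h (some (G.src e)) - h (some (G.tgt e))) := by
  simp [Matrix.mulVec, dotProduct, augIncMatrix, sub_mul, Fintype.sum_option]

theorem mem_circulationPolytope_iff [Fintype E] [DecidableEq V] (G : DirMultigraph V E)
    (v : E → ℝ) : v ∈ G.circulationPolytope ↔
      (∀ e, 0 ≤ v e) ∧ G.augIncMatrix.mulVec v = Pi.single none 1 := by
  refine and_congr_right fun _ => ⟨fun h => funext fun x => ?_, fun h => ⟨?_, fun x => ?_⟩⟩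
  · cases x with
    | none => simpa [augIncMatrix_mulVec_none] using h.1
    | some x => simpa [augIncMatrix_mulVec_some, sub_eq_zero] using h.2 x
  · simpa [augIncMatrix_mulVec_none] using congrFun h none
  · simpa [augIncMatrix_mulVec_some, sub_eq_zero] using congrFun h (some x)

/-- The `|V| + 1` rows satisfy a single linear relation. Pairing a relation `h` with a circulation
cancels the potential differences and leaves `h none = 0`; then `h` agrees at the ends of every
edge, hence is constant on `V` by `hcon`. -/
theorem rank_augIncMatrix [Fintype E] [Fintype V] [DecidableEq V] [Nonempty V]
    (G : DirMultigraph V E)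
    (hcon : ∀ h : V → ℝ, (∀ e, h (G.src e) = h (G.tgt e)) → ∀ x y, h x = h y)
    (hne : G.circulationPolytope.Nonempty) : G.augIncMatrix.rank = Fintype.card V := by
  obtain ⟨u, hu⟩ := hne
  rw [mem_circulationPolytope_iff] at hu
  have hker : Module.finrank ℝ (LinearMap.ker G.augIncMatrix.transpose.mulVecLin) = 1 := by
    let w : Option V → ℝ := fun x => x.elim 0 fun _ => 1
    have hw : w ∈ LinearMap.ker G.augIncMatrix.transpose.mulVecLin := by
      rw [LinearMap.mem_ker]
      funext e
      exact (augIncMatrix_transpose_mulVec G w e).trans (by simp [w])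
    obtain ⟨x₀⟩ := ‹Nonempty V›
    refine (finrank_eq_one_iff_of_nonzero' ⟨w, hw⟩ fun h0 => ?_).2 ?_
    · have := congrFun (congrArg Subtype.val h0) (some x₀)
      simp [w] at this
    · rintro ⟨h, hh⟩
      rw [LinearMap.mem_ker, Matrix.mulVecLin_apply] at hh
      have h0 : h none = 0 := by
        have h1 : dotProduct u (G.augIncMatrix.transpose.mulVec h) = h none := by
          rw [Matrix.dotProduct_mulVec, Matrix.vecMul_transpose, hu.2, single_dotProduct, one_mul]
        rw [← h1, hh, dotProduct_zero]
      have hc := hcon (fun x => h (some x)) fun e => by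
        have := congrFun hh e
        rw [augIncMatrix_transpose_mulVec, h0] at this
        simpa [sub_eq_zero] using this
      refine ⟨h (some x₀), Subtype.ext (funext fun x => ?_)⟩
      cases x with
      | none => simp [w, h0]
      | some x => simpa [w] using hc x₀ x
  have := LinearMap.finrank_range_add_finrank_ker G.augIncMatrix.transpose.mulVecLin
  rw [hker] at this
  rw [← Matrix.rank_transpose, Matrix.rank]
  simpa using this

/-- At a strictly positive circulation the sign constraints are slack, so a small step along any
kernel vector stays in the polytope. -/
theorem vectorSpan_circulationPolytope [Fintype E] [DecidableEq V] (G : DirMultigraph V E)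
    {u : E → ℝ} (hu : u ∈ G.circulationPolytope) (hpos : ∀ e, 0 < u e) :
    vectorSpan ℝ G.circulationPolytope = LinearMap.ker G.augIncMatrix.mulVecLin := by
  apply le_antisymm
  · rw [vectorSpan_def, Submodule.span_le]
    rintro _ ⟨v, hv, w, hw, rfl⟩
    rw [mem_circulationPolytope_iff] at hv hw
    simp [Matrix.mulVec_sub, hv.2, hw.2]
  · intro w hw
    rw [LinearMap.mem_ker, Matrix.mulVecLin_apply] at hw
    obtain ⟨ε, hε, hle⟩ : ∃ ε : ℝ, 0 < ε ∧ ∀ e, ε * |w e| ≤ u e := by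
      rcases isEmpty_or_nonempty E with _ | _
      · exact ⟨1, one_pos, fun e => isEmptyElim e⟩
      · obtain ⟨e₀, h₀⟩ := Finite.exists_min u
        have hS : 0 ≤ ∑ e, |w e| := Finset.sum_nonneg fun e _ => abs_nonneg _
        have := hpos e₀
        refine ⟨u e₀ / (∑ e, |w e| + 1), by positivity, fun e => ?_⟩
        have h1 : |w e| ≤ ∑ e, |w e| :=
          Finset.single_le_sum (f := fun e => |w e|) (fun e _ => abs_nonneg _) (by simp)
        calc u e₀ / (∑ e, |w e| + 1) * |w e| ≤ u e₀ / (∑ e, |w e| + 1) * (∑ e, |w e| + 1) := by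
              gcongr
              linarith
          _ = u e₀ := by field_simp
          _ ≤ u e := h₀ e
    have hmem : u + ε • w ∈ G.circulationPolytope := by
      rw [mem_circulationPolytope_iff] at hu ⊢
      refine ⟨fun e => ?_, by rw [Matrix.mulVec_add, Matrix.mulVec_smul, hw, hu.2]; simp⟩
      have h1 := hle e
      have h2 := mul_le_mul_of_nonneg_left (neg_abs_le (w e)) hε.le
      simp only [Pi.add_apply, Pi.smul_apply, smul_eq_mul]
      linarith
    have h := Submodule.smul_mem _ ε⁻¹ (vsub_mem_vectorSpan ℝ hmem hu)
    simpa [smul_smul, hε.ne'] using h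

theorem finrank_vectorSpan_circulationPolytope [Fintype E] [Fintype V] [DecidableEq V]
    [Nonempty V] (G : DirMultigraph V E)
    (hcon : ∀ h : V → ℝ, (∀ e, h (G.src e) = h (G.tgt e)) → ∀ x y, h x = h y)
    {u : E → ℝ} (hu : u ∈ G.circulationPolytope) (hpos : ∀ e, 0 < u e) :
    Fintype.card V + Module.finrank ℝ (vectorSpan ℝ G.circulationPolytope) = Fintype.card E := by
  rw [vectorSpan_circulationPolytope G hu hpos, ← G.rank_augIncMatrix hcon ⟨u, hu⟩, Matrix.rank,
    LinearMap.finrank_range_add_finrank_ker, Module.finrank_fintype_fun_eq_card]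

end DirMultigraph

/-! ### Relative order and windows of sequences -/

namespace PermPattern

theorem SameOrder.symm {m : ℕ} {α β : Type*} [LT α] [LT β] {f : Fin m → α} {g : Fin m → β}
    (h : SameOrder f g) : SameOrder g f := fun a b => (h a b).symm

theorem SameOrder.trans {m : ℕ} {α β γ : Type*} [LT α] [LT β] [LT γ] {f : Fin m → α}
    {g : Fin m → β} {h : Fin m → γ} (hfg : SameOrder f g) (hgh : SameOrder g h) : SameOrder f h :=
  fun a b => (hfg a b).trans (hgh a b)

theorem SameOrder.perm_eq {m : ℕ} {π π' : Equiv.Perm (Fin m)} (h : SameOrder π π') : π = π' := by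
  have h1 : StrictMono (π' ∘ π.symm) := by
    intro a b hab
    exact (h (π.symm a) (π.symm b)).1 (by simpa using hab)
  have h2 : (π' ∘ π.symm : Fin m → Fin m) = id :=
    (h1.range_inj strictMono_id).1 (by
      rw [Set.range_id, (π'.surjective.comp π.symm.surjective).range_eq])
  ext a
  simpa using congrArg Fin.val (congrFun h2 (π a)).symm

theorem pat_eq_iff {m : ℕ} {α : Type*} [LinearOrder α] {f : Fin m → α}
    (hf : Function.Injective f) {π : Equiv.Perm (Fin m)} : pat f = π ↔ SameOrder π f :=
  ⟨fun h => h ▸ sameOrder_pat f hf, fun h => ((sameOrder_pat f hf).trans h.symm).perm_eq⟩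

/-- The `m` consecutive entries of the sequence `f` that start at the index `i`. -/
def window (f : ℕ → ℚ) (m i : ℕ) : Fin m → ℚ := fun a => f (i + a)

theorem window_injective {f : ℕ → ℚ} {n m i : ℕ} (hf : Set.InjOn f (Set.Iio n)) (h : i + m ≤ n) :
    Function.Injective (window f m i) := by
  intro a b hab
  have := hf (Set.mem_Iio.2 (by omega)) (Set.mem_Iio.2 (by omega)) hab
  exact Fin.ext (by omega)

theorem src_pat {k : ℕ} (f : Fin k → ℚ) (hf : Function.Injective f) :
    (overlapGraph k).src (pat f) = pat (fun a : Fin (k - 1) => f ⟨a, by omega⟩) := by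
  refine (pat_eq_iff fun a b hab => ?_).2 fun a b => ?_
  · simpa [Fin.ext_iff] using hab
  · rw [sameOrder_pat f hf]
    refine sameOrder_pat _ (fun a b hab => ?_) a b
    simpa [Fin.ext_iff] using hf hab

theorem tgt_pat {k : ℕ} (f : Fin k → ℚ) (hf : Function.Injective f) :
    (overlapGraph k).tgt (pat f) = pat (fun a : Fin (k - 1) => f ⟨a + 1, by omega⟩) := by
  refine (pat_eq_iff fun a b hab => ?_).2 fun a b => ?_
  · simpa [Fin.ext_iff] using hab
  · rw [sameOrder_pat f hf]
    refine sameOrder_pat _ (fun a b hab => ?_) a b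
    simpa [Fin.ext_iff] using hf hab

theorem src_pat_window {f : ℕ → ℚ} {k i : ℕ} (h : Function.Injective (window f k i)) :
    (overlapGraph k).src (pat (window f k i)) = pat (window f (k - 1) i) :=
  src_pat _ h

theorem tgt_pat_window {f : ℕ → ℚ} {k i : ℕ} (h : Function.Injective (window f k i)) :
    (overlapGraph k).tgt (pat (window f k i)) = pat (window f (k - 1) (i + 1)) := by
  rw [tgt_pat _ h]
  congr 1
  funext a
  simp only [window]
  congr 1
  omega

/-- The sequence that lists the entries of `σ`, then the entries of `τ` shifted upwards, and then
increases. -/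
def joinSeq {n m : ℕ} (σ : Equiv.Perm (Fin n)) (τ : Equiv.Perm (Fin m)) (i : ℕ) : ℚ :=
  if h : i < n then ((σ ⟨i, h⟩ : ℕ) : ℚ) else
    if h' : i - n < m then ((n + τ ⟨i - n, h'⟩ : ℕ) : ℚ) else i

theorem joinSeq_injective {n m : ℕ} (σ : Equiv.Perm (Fin n)) (τ : Equiv.Perm (Fin m)) :
    Function.Injective (joinSeq σ τ) := by
  intro i j hij
  unfold joinSeq at hij
  split_ifs at hij with h1 h2 h3 h4 h5 h6 h7 h8 <;> norm_cast at hij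
  · simpa using σ.injective (Fin.ext hij)
  all_goals try omega
  have := τ.injective (Fin.ext (Nat.add_left_cancel hij))
  simp at this
  omega

theorem sameOrder_joinSeq_left {n m : ℕ} (σ : Equiv.Perm (Fin n)) (τ : Equiv.Perm (Fin m)) :
    SameOrder σ (window (joinSeq σ τ) n 0) := by
  intro a b
  simp [window, joinSeq]

theorem sameOrder_joinSeq_right {n m : ℕ} (σ : Equiv.Perm (Fin n)) (τ : Equiv.Perm (Fin m)) :
    SameOrder τ (window (joinSeq σ τ) m n) := by
  intro a b
  simp [window, joinSeq]

theorem window_injective' {f : ℕ → ℚ} (hf : Function.Injective f) (m i : ℕ) :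
    Function.Injective (window f m i) :=
  window_injective hf.injOn le_rfl

/-! ### Connectivity and dimension for the overlap graph -/

/-- The overlap graph is connected. -/
theorem overlapGraph_connected {k : ℕ} {α : Type*} (h : Equiv.Perm (Fin (k - 1)) → α)
    (hh : ∀ e, h ((overlapGraph k).src e) = h ((overlapGraph k).tgt e))
    (ρ τ : Equiv.Perm (Fin (k - 1))) : h ρ = h τ := by
  have hf := joinSeq_injective ρ τ
  -- Consecutive windows are the ends of an edge, so `h` is constant along the walk that runs from
  -- `ρ` at index `0` to `τ` at index `k - 1`.
  have hi : ∀ i, h (pat (window (joinSeq ρ τ) (k - 1) i)) =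
      h (pat (window (joinSeq ρ τ) (k - 1) 0)) := by
    intro i
    induction i with
    | zero => rfl
    | succ i ih => rw [← ih, ← tgt_pat_window (window_injective' hf k i), ← hh,
        src_pat_window (window_injective' hf k i)]
  have h1 := hi (k - 1)
  rw [(pat_eq_iff (window_injective' hf _ _)).2 (sameOrder_joinSeq_left ρ τ),
    (pat_eq_iff (window_injective' hf _ _)).2 (sameOrder_joinSeq_right ρ τ)] at h1
  exact h1.symm

/-- Rotation moves the first `k - 1` entries to the last `k - 1` places. It thus matches the edges
leaving a vertex with those entering it, which makes the uniform vector a circulation. -/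
theorem tgt_mul_finRotate_symm {k : ℕ} (hk : 1 ≤ k) (π : Equiv.Perm (Fin k)) :
    (overlapGraph k).tgt (π * (finRotate k)⁻¹) = (overlapGraph k).src π := by
  obtain ⟨j, rfl⟩ := Nat.exists_eq_add_of_le' hk
  simp only [overlapGraph]
  congr 1
  funext a
  rw [Equiv.Perm.mul_apply]
  congr 1
  rw [Equiv.Perm.inv_eq_iff_eq, finRotate_apply]
  ext
  rw [Fin.val_add_one_of_lt]
  simp only [Fin.lt_def, Fin.val_last]
  omega

theorem uniform_mem_circulationPolytope {k : ℕ} (hk : 1 ≤ k) :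
    (fun _ => ((k.factorial : ℝ))⁻¹) ∈ (overlapGraph k).circulationPolytope := by
  refine ⟨fun e => by positivity, ?_, fun x => ?_⟩
  · simp [Fintype.card_perm, Nat.factorial_ne_zero]
  · simp only [Finset.sum_const]
    congr 1
    refine Finset.card_bij (fun π _ => π * (finRotate k)⁻¹) ?_ ?_ ?_
    · intro π hπ
      simpa [tgt_mul_finRotate_symm hk] using hπ
    · simp
    · intro π hπ
      refine ⟨π * finRotate k, ?_, by simp⟩
      rw [Finset.mem_filter, ← tgt_mul_finRotate_symm hk]
      simpa using hπ

theorem finrank_vectorSpan_overlapGraph {k : ℕ} (hk : 1 ≤ k) :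
    (Module.finrank ℝ (vectorSpan ℝ (overlapGraph k).circulationPolytope) : ℤ) =
      (Nat.factorial k : ℤ) - (Nat.factorial (k - 1) : ℤ) := by
  have := (overlapGraph k).finrank_vectorSpan_circulationPolytope
    (fun h hh => overlapGraph_connected h hh) (uniform_mem_circulationPolytope hk)
    (fun _ => by positivity)
  simp only [Fintype.card_perm, Fintype.card_fin] at this
  omega

/-! ### Limits of pattern proportions are circulations -/

/-- The number of indices `i < M` at which the sequence `f` has an occurrence of `π`. -/
def occCount {k : ℕ} (π : Equiv.Perm (Fin k)) (f : ℕ → ℚ) (M : ℕ) : ℕ :=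
  ((Finset.range M).filter fun i => pat (window f k i) = π).card

theorem coc_eq_occCount {k n : ℕ} (hk : 1 ≤ k) (π : Equiv.Perm (Fin k)) (σ : Equiv.Perm (Fin n))
    {f : ℕ → ℚ} (hf : Set.InjOn f (Set.Iio n)) (hσ : SameOrder σ (window f n 0)) :
    coc π σ = occCount π f (n + 1 - k) := by
  unfold coc occCount
  congr 1
  ext i
  simp only [Finset.mem_filter, Finset.mem_range]
  have key : ∀ h : i + k ≤ n, SameOrder (fun a : Fin k => σ ⟨i + a, by omega⟩) (window f k i) := by
    intro h a b
    rw [hσ]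
    simp [window]
  constructor
  · rintro ⟨-, h, hs⟩
    exact ⟨by omega, (pat_eq_iff (window_injective hf h)).2 (hs.trans (key h))⟩
  · rintro ⟨hi, hp⟩
    have h : i + k ≤ n := by omega
    exact ⟨by omega, h, ((pat_eq_iff (window_injective hf h)).1 hp).trans (key h).symm⟩

theorem sum_occCount_filter {k : ℕ} (p : Equiv.Perm (Fin k) → Prop) [DecidablePred p]
    (f : ℕ → ℚ) (M : ℕ) : ∑ π with p π, occCount π f M =
      ((Finset.range M).filter fun i => p (pat (window f k i))).card := by
  unfold occCount
  rw [Finset.card_eq_sum_card_fiberwise (f := fun i => pat (window f k i))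
    (t := Finset.univ.filter p) (by intro i hi; simpa using (Finset.mem_filter.1 hi).2)]
  refine Finset.sum_congr rfl fun π hπ => ?_
  congr 1
  ext i
  simp only [Finset.mem_filter, Finset.mem_univ, true_and] at hπ ⊢
  constructor
  · rintro ⟨h1, rfl⟩
    exact ⟨⟨h1, hπ⟩, rfl⟩
  · rintro ⟨⟨h1, -⟩, h2⟩
    exact ⟨h1, h2⟩

theorem sum_occCount {k : ℕ} (f : ℕ → ℚ) (M : ℕ) :
    ∑ π : Equiv.Perm (Fin k), occCount π f M = M := by
  simpa using sum_occCount_filter (k := k) (fun _ => True) f M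

/-- The two counts differ only in the terms at `0` and at `M`. -/
theorem card_filter_range_shift (p : ℕ → Prop) [DecidablePred p] (M : ℕ) :
    |(((Finset.range M).filter p).card : ℝ) - ((Finset.range M).filter fun i => p (i + 1)).card|
      ≤ 1 := by
  have h1 := Finset.sum_range_succ (fun i => if p i then (1 : ℝ) else 0) M
  have h2 := Finset.sum_range_succ' (fun i => if p i then (1 : ℝ) else 0) M
  rw [Finset.card_filter, Finset.card_filter]
  push_cast
  rw [abs_le]
  split_ifs at h1 h2 <;> constructor <;> linarith

theorem abs_sum_occCount_sub_le {k M : ℕ} {f : ℕ → ℚ} (hf : Function.Injective f)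
    (x : Equiv.Perm (Fin (k - 1))) :
    |∑ π with (overlapGraph k).src π = x, (occCount π f M : ℝ) -
      ∑ π with (overlapGraph k).tgt π = x, (occCount π f M : ℝ)| ≤ 1 := by
  rw [← Nat.cast_sum, ← Nat.cast_sum, sum_occCount_filter, sum_occCount_filter]
  simp only [src_pat_window (window_injective' hf _ _), tgt_pat_window (window_injective' hf _ _)]
  exact card_filter_range_shift (fun i => pat (window f (k - 1) i) = x) M

theorem exists_seq {n : ℕ} (σ : Equiv.Perm (Fin n)) :
    ∃ f : ℕ → ℚ, Function.Injective f ∧ SameOrder σ (window f n 0) :=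
  ⟨_, joinSeq_injective σ (1 : Equiv.Perm (Fin 0)), sameOrder_joinSeq_left _ _⟩

theorem abs_sum_coc_sub_le {k n : ℕ} (hk : 1 ≤ k) (σ : Equiv.Perm (Fin n)) :
    |∑ π : Equiv.Perm (Fin k), (coc π σ : ℝ) - n| ≤ k := by
  obtain ⟨f, hf, hσ⟩ := exists_seq σ
  simp only [coc_eq_occCount hk _ σ hf.injOn hσ]
  rw [← Nat.cast_sum, sum_occCount, abs_le]
  have h1 : (n : ℝ) ≤ ((n + 1 - k : ℕ) : ℝ) + k := by exact_mod_cast (by omega)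
  have h2 : ((n + 1 - k : ℕ) : ℝ) ≤ n + k := by exact_mod_cast (by omega)
  constructor <;> linarith

theorem abs_sum_coc_src_sub_tgt_le {k n : ℕ} (hk : 1 ≤ k) (σ : Equiv.Perm (Fin n))
    (x : Equiv.Perm (Fin (k - 1))) :
    |∑ π with (overlapGraph k).src π = x, (coc π σ : ℝ) -
      ∑ π with (overlapGraph k).tgt π = x, (coc π σ : ℝ)| ≤ 1 := by
  obtain ⟨f, hf, hσ⟩ := exists_seq σ
  simp only [coc_eq_occCount hk _ σ hf.injOn hσ]
  exact abs_sum_occCount_sub_le hf x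

theorem tendsto_zero_of_abs_le_div {a : ℕ → ℝ} {n : ℕ → ℕ} (hn : Filter.Tendsto n .atTop .atTop)
    (c : ℝ) (h : ∀ m, 0 < n m → |a m| ≤ c / n m) : Filter.Tendsto a .atTop (nhds 0) := by
  have h1 : Filter.Tendsto (fun m => c / (n m : ℝ)) .atTop (nhds 0) :=
    (tendsto_const_div_atTop_nhds_zero_nat c).comp hn
  refine squeeze_zero_norm' ?_ h1
  filter_upwards [hn.eventually_gt_atTop 0] with m hm using h m hm

theorem feasibleRegion_subset_circulationPolytope {k : ℕ} (hk : 1 ≤ k) :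
    feasibleRegion k ⊆ (overlapGraph k).circulationPolytope := by
  rintro v ⟨hv, σ, hσ, hlim⟩
  refine ⟨fun e => (hv e).1, ?_, fun x => ?_⟩
  · have h1 : Filter.Tendsto (fun m => ∑ π : Equiv.Perm (Fin k), cocProp π (σ m).2 - 1) .atTop
        (nhds (∑ π, v π - 1)) := (tendsto_finsetSum _ fun π _ => hlim π).sub_const 1
    have h2 := tendsto_zero_of_abs_le_div
      (a := fun m => ∑ π : Equiv.Perm (Fin k), cocProp π (σ m).2 - 1) hσ k fun m hm => by
        have hm' : (0 : ℝ) < (σ m).1 := by exact_mod_cast hm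
        simp only [cocProp]
        rw [← Finset.sum_div, div_sub_one hm'.ne', abs_div, abs_of_pos hm']
        gcongr
        exact abs_sum_coc_sub_le hk _
    linarith [tendsto_nhds_unique h1 h2]
  · have h1 : Filter.Tendsto (fun m => ∑ π with (overlapGraph k).src π = x, cocProp π (σ m).2 -
        ∑ π with (overlapGraph k).tgt π = x, cocProp π (σ m).2) .atTop
        (nhds (∑ π with (overlapGraph k).src π = x, v π -
          ∑ π with (overlapGraph k).tgt π = x, v π)) :=
      (tendsto_finsetSum _ fun π _ => hlim π).sub (tendsto_finsetSum _ fun π _ => hlim π)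
    have h2 := tendsto_zero_of_abs_le_div
      (a := fun m => ∑ π with (overlapGraph k).src π = x, cocProp π (σ m).2 -
        ∑ π with (overlapGraph k).tgt π = x, cocProp π (σ m).2) hσ 1 fun m hm => by
        have hm' : (0 : ℝ) < (σ m).1 := by exact_mod_cast hm
        simp only [cocProp]
        rw [← Finset.sum_div, ← Finset.sum_div, ← sub_div, abs_div, abs_of_pos hm']
        gcongr
        exact abs_sum_coc_src_sub_tgt_le hk _ x
    linarith [tendsto_nhds_unique h1 h2]

/-! ### Realizing the cycle polytope by permutations -/

theorem occCount_le_add {k : ℕ} (π : Equiv.Perm (Fin k)) (f : ℕ → ℚ) {M M' d : ℕ}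
    (h : M ≤ M' + d) : occCount π f M ≤ occCount π f M' + d := by
  have h1 : occCount π f M ≤ occCount π f (M' + d) :=
    Finset.card_le_card (Finset.filter_subset_filter _ (Finset.range_subset_range.2 h))
  have h2 : occCount π f (M' + d) ≤ occCount π f M' + d := by
    simp only [occCount, Finset.card_filter, Finset.sum_range_add]
    gcongr
    rw [← Finset.card_filter]
    exact (Finset.card_filter_le _ _).trans (by simp)
  exact h1.trans h2

theorem window_comp_add (f : ℕ → ℚ) (a m i : ℕ) :
    window (fun i => f (a + i)) m i = window f m (a + i) := by
  funext b
  simp only [window, add_assoc]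

theorem occCount_add {k : ℕ} (π : Equiv.Perm (Fin k)) (f : ℕ → ℚ) (a b : ℕ) :
    occCount π f (a + b) = occCount π f a + occCount π (fun i => f (a + i)) b := by
  simp only [occCount, Finset.card_filter, Finset.sum_range_add, window_comp_add]

/-- Direct sums: the numbers of occurrences are additive up to a bounded error. -/
theorem exists_directSum {k n m : ℕ} (hk : 1 ≤ k) (σ : Equiv.Perm (Fin n))
    (τ : Equiv.Perm (Fin m)) : ∃ ρ : Equiv.Perm (Fin (n + m)), ∀ π : Equiv.Perm (Fin k),
      |(coc π ρ : ℝ) - (coc π σ + coc π τ)| ≤ k := by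
  set f := joinSeq σ τ with hf
  have hinj : Function.Injective f := joinSeq_injective σ τ
  refine ⟨pat (window f (n + m) 0), fun π => ?_⟩
  have hτ : SameOrder τ (window (fun i => f (n + i)) m 0) := by
    have := sameOrder_joinSeq_right σ τ
    simpa [window, SameOrder] using this
  rw [coc_eq_occCount hk π _ hinj.injOn (sameOrder_pat _ (window_injective' hinj _ _)),
    coc_eq_occCount hk π σ hinj.injOn (sameOrder_joinSeq_left σ τ),
    coc_eq_occCount hk π τ (f := fun i => f (n + i))
      (hinj.comp (add_right_injective n)).injOn hτ]
  -- Windows are split by whether they start before `n`; only those straddling the junction cause an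
  -- error.
  have h0 := occCount_add π f n (m + 1 - k)
  have h1 := occCount_le_add π f (show n + m + 1 - k ≤ n + (m + 1 - k) + 0 by omega)
  have h2 := occCount_le_add π f (show n + (m + 1 - k) ≤ (n + m + 1 - k) + k by omega)
  have h3 := occCount_le_add π f (show n ≤ (n + 1 - k) + k by omega)
  have h4 := occCount_le_add π f (show n + 1 - k ≤ n + 0 by omega)
  rw [abs_le]
  rw [h0] at h1 h2
  generalize occCount π f (n + m + 1 - k) = A at *
  generalize occCount π f (n + 1 - k) = B at *
  generalize occCount π f n = D at *
  generalize occCount π (fun i => f (n + i)) (m + 1 - k) = F at *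
  rify at h1 h2 h3 h4
  constructor <;> linarith

/-- One more step of a walk: the entry appended after the current window is chosen in the dense
order `ℚ`, so no earlier value has to change. -/
theorem exists_extension {k : ℕ} (hk : 1 ≤ k) (π : Equiv.Perm (Fin k)) {f : ℕ → ℚ} {n : ℕ}
    (hf : Set.InjOn f (Set.Iio (n + (k - 1))))
    (hs : SameOrder ((overlapGraph k).src π) (window f (k - 1) n)) :
    ∃ x, Set.InjOn (Function.update f (n + (k - 1)) x) (Set.Iio (n + 1 + (k - 1))) ∧
      SameOrder π (window (Function.update f (n + (k - 1)) x) k n) := by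
  classical
  set N := n + (k - 1) with hN
  have hs' : ∀ a b : Fin k, (a : ℕ) < k - 1 → (b : ℕ) < k - 1 →
      (π a < π b ↔ f (n + a) < f (n + b)) := by
    intro a b ha hb
    have hinj : Function.Injective (fun a : Fin (k - 1) => π ⟨a, by omega⟩) := fun a b hab => by
      simpa [Fin.ext_iff] using hab
    exact (sameOrder_pat _ hinj ⟨a, ha⟩ ⟨b, hb⟩).symm.trans (hs ⟨a, ha⟩ ⟨b, hb⟩)
  let z : Fin k := ⟨k - 1, by omega⟩
  let S := (Finset.range N).image f
  -- `P` marks the old values forced below the new one. It is closed downwards, so some `x`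
  -- separates it strictly from the remaining values and differs from all of them.
  let P : ℚ → Prop := fun s => ∃ a : Fin k, (a : ℕ) < k - 1 ∧ π a < π z ∧ s ≤ f (n + a)
  obtain ⟨x, hx1, hx2⟩ := Order.exists_between_finsets (S.filter P) (S.filter fun s => ¬ P s) (by
    intro s hs t ht
    obtain ⟨-, a, ha, haz, hle⟩ := Finset.mem_filter.1 hs
    by_contra! hts
    exact (Finset.mem_filter.1 ht).2 ⟨a, ha, haz, hts.trans hle⟩)
  have hmem : ∀ i < N, f i ∈ S := fun i hi => Finset.mem_image_of_mem _ (by simpa using hi)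
  have hxS : ∀ i < N, f i ≠ x := by
    intro i hi h
    by_cases hP : P (f i)
    · exact (hx1 _ (Finset.mem_filter.2 ⟨hmem i hi, hP⟩)).ne h
    · exact (hx2 _ (Finset.mem_filter.2 ⟨hmem i hi, hP⟩)).ne' h
  have hlow : ∀ a : Fin k, (a : ℕ) < k - 1 → (π a < π z ↔ f (n + a) < x) := by
    intro a ha
    have haS := hmem (n + a) (by omega)
    refine ⟨fun h => hx1 _ (Finset.mem_filter.2 ⟨haS, a, ha, h, le_rfl⟩), fun h => ?_⟩
    by_contra hc
    refine (hx2 _ (Finset.mem_filter.2 ⟨haS, ?_⟩)).not_gt h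
    rintro ⟨b, hb, hbz, hle⟩
    exact hle.not_gt ((hs' b a hb ha).1 (hbz.trans_le (not_lt.1 hc)))
  have hhigh : ∀ a : Fin k, (a : ℕ) < k - 1 → (π z < π a ↔ x < f (n + a)) := by
    intro a ha
    have h1 : π a ≠ π z := fun h => by
      have := congrArg Fin.val (π.injective h)
      simp only [z] at this
      omega
    have h2 := hxS (n + a) (by omega)
    rw [← not_le, ← not_le, h1.le_iff_lt, h2.le_iff_lt, hlow a ha]
  have hold : ∀ i < N, Function.update f N x i = f i := fun i hi =>
    Function.update_of_ne hi.ne _ _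
  refine ⟨x, ?_, fun a b => ?_⟩
  · intro i hi j hj hij
    have hi' : i < N ∨ i = N := by simp only [Set.mem_Iio] at hi; omega
    have hj' : j < N ∨ j = N := by simp only [Set.mem_Iio] at hj; omega
    rcases hi' with hi' | rfl <;> rcases hj' with hj' | rfl
    · rw [hold i hi', hold j hj'] at hij
      exact hf hi' hj' hij
    · rw [hold i hi', Function.update_self] at hij
      exact absurd hij (hxS i hi')
    · rw [hold j hj', Function.update_self] at hij
      exact absurd hij.symm (hxS j hj')
    · rfl
  · have hz : ∀ a : Fin k, (a : ℕ) < k - 1 ∨ a = z := fun a => by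
      rw [Fin.ext_iff]
      simp only [z]
      omega
    have hwz : window (Function.update f N x) k n z = x := Function.update_self _ _ _
    have hw : ∀ a : Fin k, (a : ℕ) < k - 1 → window (Function.update f N x) k n a = f (n + a) :=
      fun a ha => hold _ (by omega)
    rcases hz a with ha | rfl <;> rcases hz b with hb | rfl
    · rw [hw a ha, hw b hb, hs' a b ha hb]
    · rw [hw a ha, hwz, hlow a ha]
    · rw [hw b hb, hwz, hhigh b hb]
    · simp

/-- Every walk in the overlap graph is realized by a sequence. -/
theorem exists_seq_of_walk {k : ℕ} (hk : 1 ≤ k) (e : ℕ → Equiv.Perm (Fin k))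
    (he : ∀ i, (overlapGraph k).tgt (e i) = (overlapGraph k).src (e (i + 1))) (n : ℕ) :
    ∃ f : ℕ → ℚ, Set.InjOn f (Set.Iio (n + (k - 1))) ∧
      (∀ i < n, SameOrder (e i) (window f k i)) ∧
      SameOrder ((overlapGraph k).src (e n)) (window f (k - 1) n) := by
  induction n with
  | zero =>
    obtain ⟨f, hf, hs⟩ := exists_seq ((overlapGraph k).src (e 0))
    exact ⟨f, hf.injOn, by simp, hs⟩
  | succ n ih =>
    obtain ⟨f, hf, hw, hs⟩ := ih
    obtain ⟨x, hx, hxw⟩ := exists_extension hk (e n) hf hs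
    refine ⟨_, hx, fun i hi => ?_, ?_⟩
    · rcases Nat.lt_succ_iff_lt_or_eq.1 hi with hi | rfl
      · intro a b
        rw [hw i hi a b]
        simp only [window]
        rw [Function.update_of_ne (by omega), Function.update_of_ne (by omega)]
      · exact hxw
    · have hinj := window_injective (m := k) (i := n) hx (by omega)
      rw [← he, ← (pat_eq_iff hinj).2 hxw, tgt_pat_window hinj]
      exact sameOrder_pat _ (window_injective hx (by omega))

/-- Up to a bounded error, every nonnegative multiple of `v` is the vector of numbers of
occurrences in a permutation whose size is the sum of the entries. -/
def IsRealizable {k : ℕ} (v : Equiv.Perm (Fin k) → ℝ) : Prop :=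
  ∃ K : ℝ, ∀ t : ℝ, 0 ≤ t → ∃ (n : ℕ) (σ : Equiv.Perm (Fin n)),
    |(n : ℝ) - t * ∑ π, v π| ≤ K ∧ ∀ π, |(coc π σ : ℝ) - t * v π| ≤ K

/-- With `IsRealizable.smul`, this makes the realizable vectors a convex cone. The error bound may
grow in a sum, but stays independent of `t`. -/
theorem IsRealizable.add {k : ℕ} (hk : 1 ≤ k) {v w : Equiv.Perm (Fin k) → ℝ}
    (hv : IsRealizable v) (hw : IsRealizable w) : IsRealizable (v + w) := by
  obtain ⟨K, hK⟩ := hv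
  obtain ⟨K', hK'⟩ := hw
  refine ⟨K + K' + k, fun t ht => ?_⟩
  obtain ⟨n, σ, hn, hσ⟩ := hK t ht
  obtain ⟨m, τ, hm, hτ⟩ := hK' t ht
  obtain ⟨ρ, hρ⟩ := exists_directSum hk σ τ
  refine ⟨n + m, ρ, ?_, fun π => ?_⟩
  · have hk' : (0 : ℝ) ≤ k := by positivity
    simp only [Pi.add_apply, Finset.sum_add_distrib, Nat.cast_add]
    rw [abs_le] at *
    constructor <;> linarith
  · have h1 := hσ π
    have h2 := hτ π
    have h3 := hρ π
    rw [Pi.add_apply]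
    rw [abs_le] at h1 h2 h3 ⊢
    constructor <;> linarith

theorem IsRealizable.smul {k : ℕ} {v : Equiv.Perm (Fin k) → ℝ} (hv : IsRealizable v) {c : ℝ}
    (hc : 0 ≤ c) : IsRealizable (c • v) := by
  obtain ⟨K, hK⟩ := hv
  refine ⟨K, fun t ht => ?_⟩
  simpa [← Finset.mul_sum, mul_assoc] using hK (t * c) (by positivity)

theorem sum_range_getElem?_eq {α : Type*} [DecidableEq α] (a : α) (C : List α) :
    ∑ i ∈ Finset.range C.length, (if C[i]? = some a then 1 else 0) = C.count a := by
  induction C with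
  | nil => simp
  | cons b l ih =>
    rw [List.length_cons, Finset.sum_range_succ']
    simp [List.count_cons, ih]

theorem sum_range_mul_mod (g : ℕ → ℕ) (q L : ℕ) :
    ∑ i ∈ Finset.range (q * L), g (i % L) = q * ∑ i ∈ Finset.range L, g i := by
  induction q with
  | zero => simp
  | succ q ih =>
    rw [add_mul, one_mul, Finset.sum_range_add, ih, add_mul, one_mul]
    congr 1
    refine Finset.sum_congr rfl fun i hi => ?_
    rw [Nat.mul_add_mod', Nat.mod_eq_of_lt (Finset.mem_range.1 hi)]

/-- Going `q` times round `C` is a walk with `q * C.length` edges; the extra `k - 1` entries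
complete the last window, so the count is exact. -/
theorem exists_perm_of_isCycle {k : ℕ} (hk : 1 ≤ k) {C : List (Equiv.Perm (Fin k))}
    (hC : (overlapGraph k).IsCycle C) (q : ℕ) :
    ∃ σ : Equiv.Perm (Fin (q * C.length + (k - 1))), ∀ π, coc π σ = q * C.count π := by
  obtain ⟨h0, hc, hl⟩ := hC
  set L := C.length with hLdef
  have hL : 0 < L := List.length_pos_iff.2 h0
  have hnext : ∀ i, (hi : i < L) → (overlapGraph k).tgt C[i] =
      (overlapGraph k).src (C[(i + 1) % L]'(Nat.mod_lt _ hL)) := by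
    intro i hi
    rcases Nat.lt_or_ge (i + 1) L with h | h
    · simp only [Nat.mod_eq_of_lt h]
      exact List.isChain_iff_getElem.1 hc i h
    · obtain rfl : i = L - 1 := by omega
      simp only [Nat.sub_add_cancel hL, Nat.mod_self]
      rwa [List.getLast_eq_getElem, List.head_eq_getElem] at hl
  let e : ℕ → Equiv.Perm (Fin k) := fun i => C[i % L]'(Nat.mod_lt _ hL)
  obtain ⟨f, hf, hw, -⟩ := exists_seq_of_walk hk e (fun i => by
    simp only [e]
    rw [hnext (i % L) (Nat.mod_lt _ hL)]
    simp only [Nat.mod_add_mod]) (q * L)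
  refine ⟨pat (window f _ 0), fun π => ?_⟩
  rw [coc_eq_occCount hk π _ hf (sameOrder_pat _ (window_injective hf (by omega))),
    show q * L + (k - 1) + 1 - k = q * L by omega, ← sum_range_getElem?_eq, ← hLdef,
    ← sum_range_mul_mod, occCount, Finset.card_filter]
  refine Finset.sum_congr rfl fun i hi => ?_
  have hi' := Finset.mem_range.1 hi
  rw [(pat_eq_iff (window_injective hf (by omega))).2 (hw i hi'),
    List.getElem?_eq_getElem (Nat.mod_lt _ hL)]
  simp only [e, Option.some.injEq]
  rfl

theorem isRealizable_cycleVec {k : ℕ} (hk : 1 ≤ k) {C : List (Equiv.Perm (Fin k))}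
    (hC : (overlapGraph k).IsCycle C) : IsRealizable (DirMultigraph.cycleVec C) := by
  refine ⟨C.length + k, fun t ht => ?_⟩
  have hL : (0 : ℝ) < C.length := by exact_mod_cast List.length_pos_iff.2 hC.1
  set q := ⌊t / C.length⌋₊
  obtain ⟨σ, hσ⟩ := exists_perm_of_isCycle hk hC q
  have h1 : (q : ℝ) ≤ t / C.length := Nat.floor_le (by positivity)
  have h2 : t / C.length < q + 1 := Nat.lt_floor_add_one _
  have hk' : (0 : ℝ) ≤ k := by positivity
  refine ⟨_, σ, ?_, fun π => ?_⟩
  · rw [hC.cycleVec_mem.2.1]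
    rw [le_div_iff₀ hL] at h1
    rw [div_lt_iff₀ hL] at h2
    push_cast [Nat.cast_sub hk]
    have hk'' : (1 : ℝ) ≤ k := by exact_mod_cast hk
    rw [abs_le]
    constructor <;> linarith
  · rw [hσ, DirMultigraph.cycleVec]
    have h3 : (C.count π : ℝ) ≤ C.length := by exact_mod_cast List.count_le_length
    have h4 : ((q * C.count π : ℕ) : ℝ) - t * (C.count π / C.length) =
        -((t / C.length - q) * C.count π) := by
      push_cast
      ring
    rw [h4, abs_neg, abs_of_nonneg (mul_nonneg (by linarith) (by positivity))]
    calc (t / C.length - q) * C.count π ≤ 1 * C.length := by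
          gcongr
          linarith
      _ ≤ C.length + k := by linarith

theorem IsRealizable.mem_feasibleRegion {k : ℕ} {v : Equiv.Perm (Fin k) → ℝ}
    (hv : IsRealizable v) (hnn : ∀ π, 0 ≤ v π) (hsum : ∑ π, v π = 1) :
    v ∈ feasibleRegion k := by
  obtain ⟨K, hK⟩ := hv
  have hle : ∀ π, v π ≤ 1 := fun π =>
    hsum ▸ Finset.single_le_sum (f := v) (fun f _ => hnn f) (by simp)
  choose n σ hn hσ using fun m : ℕ => hK m (Nat.cast_nonneg m)
  simp only [hsum, mul_one] at hn
  have hlim : Filter.Tendsto n .atTop .atTop := by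
    rw [← tendsto_natCast_atTop_iff (R := ℝ)]
    refine Filter.tendsto_atTop_mono (fun m => ?_)
      (Filter.tendsto_atTop_add_const_right _ (-K) tendsto_natCast_atTop_atTop)
    have := (abs_le.1 (hn m)).1
    linarith
  refine ⟨fun π => ⟨hnn π, hle π⟩, fun m => ⟨n m, σ m⟩, hlim, fun π => ?_⟩
  rw [← tendsto_sub_nhds_zero_iff]
  -- One `K` bounds the error of the count against `m * v π`, the other the cost of replacing `m` by
  -- the true size `n m`.
  refine tendsto_zero_of_abs_le_div hlim (K + K) fun m hm => ?_
  have hm' : (0 : ℝ) < n m := by exact_mod_cast hm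
  rw [cocProp, div_sub' hm'.ne', abs_div, abs_of_pos hm']
  gcongr
  calc |(coc π (σ m) : ℝ) - n m * v π|
      = |(coc π (σ m) - m * v π) - (n m - m) * v π| := by ring_nf
    _ ≤ |coc π (σ m) - m * v π| + |(n m - m) * v π| := abs_sub _ _
    _ ≤ K + K := by
        gcongr
        · exact hσ m π
        · rw [abs_mul, abs_of_nonneg (hnn π)]
          exact (mul_le_of_le_one_right (abs_nonneg _) (hle π)).trans (hn m)

theorem cyclePolytope_subset_feasibleRegion {k : ℕ} (hk : 1 ≤ k) :
    (overlapGraph k).cyclePolytope ⊆ feasibleRegion k := by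
  intro v hv
  have hr : IsRealizable v := by
    refine convexHull_min (t := {v | IsRealizable v}) ?_ ?_ hv
    · rintro _ ⟨C, hC, rfl⟩
      exact isRealizable_cycleVec hk hC.1
    · intro v hv w hw a b ha hb _
      exact (IsRealizable.smul hv ha).add hk (IsRealizable.smul hw hb)
  rw [← DirMultigraph.circulationPolytope_eq_cyclePolytope] at hv
  exact hr.mem_feasibleRegion hv.1 hv.2.1

theorem feasibleRegion_eq_circulationPolytope {k : ℕ} (hk : 1 ≤ k) :
    feasibleRegion k = (overlapGraph k).circulationPolytope := by
  refine (feasibleRegion_subset_circulationPolytope hk).antisymm ?_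
  rw [DirMultigraph.circulationPolytope_eq_cyclePolytope]
  exact cyclePolytope_subset_feasibleRegion hk

end PermPattern

theorem theorem2p1 (k : ℕ) (hk : 1 ≤ k) :
    PermPattern.feasibleRegion k = (PermPattern.overlapGraph k).cyclePolytope ∧
    (Module.finrank ℝ (vectorSpan ℝ (PermPattern.feasibleRegion k)) : ℤ) =
      (Nat.factorial k : ℤ) - (Nat.factorial (k - 1) : ℤ) ∧
    (PermPattern.feasibleRegion k).extremePoints ℝ =
      (PermPattern.overlapGraph k).simpleCycleVecs := by
  rw [PermPattern.feasibleRegion_eq_circulationPolytope hk]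
  exact ⟨DirMultigraph.circulationPolytope_eq_cyclePolytope _,
    PermPattern.finrank_vectorSpan_overlapGraph hk,
    DirMultigraph.extremePoints_circulationPolytope _⟩
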